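/- For a real number $a$ and an integer $k\ge 0$ write $(a)_0=1$ and $(a)_k=a(a+1)\cdots(a+k-1)$. For real $\alpha,\beta>-1$, integers $0\le n\le N$ and real $x$, let $$Q_n(x,\alpha,\beta,N)=\sum_{k=0}^{n}\frac{(-n)_k\,(n+\alpha+\beta+1)_k\,(-x)_k}{k!\,(\alpha+1)_k\,(-N)_k}$$ be the $n$th Hahn polynomial. **Theorem 3.2.** Let $\alpha,\beta>-1$ be real with $\alpha+\beta>-1$, let $0\le n\le N$ be integers, and suppose that $$n\le n(\alpha,\beta,N):=-\tfrac12\Big\{(\alpha+\beta-1)-\sqrt{(\alpha+\beta+1)(\alpha+\beta+2N+1)}\Big\}.$$ Then for all real $x\in[0,N]$ $$|Q_n(x,\alpha,\beta,N)|\le\max\Big\{1,\frac{(\beta+1)_n}{(\alpha+1)_n}\Big\}=\max\big\{|Q_n(0,\alpha,\beta,N)|,\,|Q_n(N,\alpha,\beta,N)|\big\}.$$ -/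

import Mathlib

noncomputable section

/-- The rising factorial `(a)_k = a (a + 1) ⋯ (a + k - 1)`, with `(a)_0 = 1`. -/
def risingFactorial (a : ℝ) (k : ℕ) : ℝ := (ascPochhammer ℝ k).eval a

/-- The Hahn polynomial `Q_n(x, α, β, N)`, as a function of a real variable `x`, given by the
terminating hypergeometric series `₃F₂(-n, n + α + β + 1, -x; α + 1, -N; 1)`. For `α > -1` and
`n ≤ N` none of the denominators vanishes. -/
def hahnQ (n : ℕ) (x α β : ℝ) (N : ℕ) : ℝ :=
  ∑ k ∈ Finset.range (n + 1),
    (risingFactorial (-(n : ℝ)) k * risingFactorial ((n : ℝ) + α + β + 1) k *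
        risingFactorial (-x) k) /
      ((Nat.factorial k : ℝ) * risingFactorial (α + 1) k * risingFactorial (-(N : ℝ)) k)

/-- The degree threshold `n(α, β, N)`. -/
def hahnDegreeBound (α β : ℝ) (N : ℕ) : ℝ :=
  -(1 / 2) * ((α + β - 1) - √((α + β + 1) * (α + β + 2 * (N : ℝ) + 1)))

end

/-! Write `p_n = Q_n(x, α, β, N)`, `v_n = Q_n(x, α, β + 1, N - 1)` and follow the energy `p_n² + ((N
- x)/x)(p_n - v_n)²`, equal to 1 at `n = 0`. By `hahnQ_succ`, replacing `p_n` by `p_{n+1}` with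
`v_n` fixed multiplies it by at most `max 1 ((β+n+1)/(α+n+1))²` (`quadratic_step`). By
`hahnQ_succ_sub_shift`, replacing `v_n` by `v_{n+1}` does not increase it in the degree range
considered. The product of the factors is the square of the claimed bound, according to the sign of
`β - α`. -/

theorem risingFactorial_zero (a : ℝ) : risingFactorial a 0 = 1 := by
  simp [risingFactorial]

theorem risingFactorial_succ (a : ℝ) (k : ℕ) :
    risingFactorial a (k + 1) = risingFactorial a k * (a + k) := by
  simp [risingFactorial, ascPochhammer_succ_eval]

theorem risingFactorial_succ_left (a : ℝ) (k : ℕ) :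
    risingFactorial a (k + 1) = a * risingFactorial (a + 1) k := by
  simp [risingFactorial, ascPochhammer_succ_left]

theorem risingFactorial_add_one_mul (a : ℝ) (k : ℕ) :
    a * risingFactorial (a + 1) k = risingFactorial a k * (a + k) := by
  rw [← risingFactorial_succ_left, risingFactorial_succ]

theorem risingFactorial_pos {a : ℝ} (ha : 0 < a) (k : ℕ) : 0 < risingFactorial a k :=
  ascPochhammer_pos k a ha

theorem risingFactorial_neg_ne_zero {m k : ℕ} (h : k ≤ m) :
    risingFactorial (-(m : ℝ)) k ≠ 0 := by
  induction k with
  | zero => simp [risingFactorial_zero]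
  | succ k ih =>
    rw [risingFactorial_succ]
    have hk : (k : ℝ) + 1 ≤ m := by exact_mod_cast h
    exact mul_ne_zero (ih (by omega)) (by linarith)

theorem risingFactorial_neg_succ_self (n : ℕ) : risingFactorial (-(n : ℝ)) (n + 1) = 0 := by
  simp [risingFactorial_succ]

/-- The `k`-th summand of `hahnQ`. -/
noncomputable def hahnTerm (n : ℕ) (x α β : ℝ) (N k : ℕ) : ℝ :=
  (risingFactorial (-(n : ℝ)) k * risingFactorial ((n : ℝ) + α + β + 1) k *
      risingFactorial (-x) k) /
    ((Nat.factorial k : ℝ) * risingFactorial (α + 1) k * risingFactorial (-(N : ℝ)) k)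

theorem hahnQ_eq_sum (n : ℕ) (x α β : ℝ) (N : ℕ) :
    hahnQ n x α β N = ∑ k ∈ Finset.range (n + 1), hahnTerm n x α β N k := rfl

theorem hahnTerm_zero (n : ℕ) (x α β : ℝ) (N : ℕ) : hahnTerm n x α β N 0 = 1 := by
  simp [hahnTerm, risingFactorial_zero]

theorem hahnTerm_succ_self (n : ℕ) (x α β : ℝ) (N : ℕ) : hahnTerm n x α β N (n + 1) = 0 := by
  simp [hahnTerm, risingFactorial_neg_succ_self]

theorem hahnQ_eq_sum_succ (n : ℕ) (x α β : ℝ) (N : ℕ) :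
    hahnQ n x α β N = ∑ k ∈ Finset.range (n + 1 + 1), hahnTerm n x α β N k := by
  rw [Finset.sum_range_succ, hahnTerm_succ_self, add_zero, hahnQ_eq_sum]

theorem hahnQ_degree_zero (x α β : ℝ) (N : ℕ) : hahnQ 0 x α β N = 1 := by
  simp [hahnQ_eq_sum, hahnTerm_zero]

theorem hahnQ_zero (n : ℕ) (α β : ℝ) (N : ℕ) : hahnQ n 0 α β N = 1 := by
  rw [hahnQ_eq_sum, Finset.sum_range_succ', hahnTerm_zero]
  simp [hahnTerm, risingFactorial_succ_left]

/-! ### Contiguous relations and the value at the right endpoint -/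

/-- The partial sums of the difference of the two sides in `hahnQ_succ` telescope. -/
theorem sum_hahnTerm_telescope (α β x : ℝ) (hα : -1 < α) (M n : ℕ) (hn : n ≤ M) (m : ℕ)
    (hm : m ≤ n) :
    ∑ k ∈ Finset.range (m + 1),
        ((α + n + 1) * hahnTerm (n + 1) x α β (M + 1) k +
          (β + n + 1) * hahnTerm n x α β (M + 1) k -
          (2 * n + α + β + 2) * (1 - x / (M + 1)) * hahnTerm n x α (β + 1) M k) =
      -((2 * n + α + β + 2) / (M + 1)) * (hahnTerm n x α (β + 1) M m * (m - x)) := by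
  have hM : (M : ℝ) + 1 ≠ 0 := by positivity
  induction m with
  | zero =>
    simp only [zero_add, Finset.sum_range_one, hahnTerm_zero]
    field_simp
    push_cast
    ring
  | succ m ih =>
    rw [Finset.sum_range_succ, ih (by omega)]
    have e1 : risingFactorial (-((n : ℝ) + 1)) (m + 1)
        = -((n : ℝ) + 1) * risingFactorial (-(n : ℝ)) m := by
      rw [risingFactorial_succ_left]; congr 2; ring
    have e2 : risingFactorial ((n : ℝ) + α + β + 1) (m + 1)
        = ((n : ℝ) + α + β + 1) * risingFactorial ((n : ℝ) + α + β + 2) m := by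
      rw [risingFactorial_succ_left]; congr 2; ring
    have e3 : risingFactorial (-((M : ℝ) + 1)) (m + 1)
        = -((M : ℝ) + 1) * risingFactorial (-(M : ℝ)) m := by
      rw [risingFactorial_succ_left]; congr 2; ring
    have e4 : (n : ℝ) + 1 + α + β + 1 = (n : ℝ) + α + β + 2 := by ring
    have e5 : (n : ℝ) + α + (β + 1) + 1 = (n : ℝ) + α + β + 2 := by ring
    have hC := (risingFactorial_pos (show 0 < α + 1 by linarith) m).ne'
    have hC' : α + 1 + m ≠ 0 := by
      have : (0 : ℝ) ≤ m := m.cast_nonneg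
      linarith
    have hD := risingFactorial_neg_ne_zero (show m ≤ M by omega)
    have hD' : -(M : ℝ) + m ≠ 0 := by
      have : (m : ℝ) + 1 ≤ M := by exact_mod_cast hm.trans hn
      linarith
    have hF : (Nat.factorial m : ℝ) ≠ 0 := by exact_mod_cast m.factorial_ne_zero
    have hm1 : (m : ℝ) + 1 ≠ 0 := by positivity
    simp only [hahnTerm, Nat.cast_add, Nat.cast_one, e4, e5, e1, e2, e3, Nat.factorial_succ,
      Nat.cast_mul, risingFactorial_succ _ m]
    generalize risingFactorial (-(n : ℝ)) m = X
    generalize risingFactorial ((n : ℝ) + α + β + 2) m = Y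
    generalize risingFactorial (-x) m = Z
    generalize risingFactorial (α + 1) m = C at hC ⊢
    generalize risingFactorial (-(M : ℝ)) m = D at hD ⊢
    generalize (Nat.factorial m : ℝ) = F at hF ⊢
    field_simp
    ring

theorem hahnQ_succ (α β x : ℝ) (hα : -1 < α) (M n : ℕ) (hn : n ≤ M) :
    (α + n + 1) * hahnQ (n + 1) x α β (M + 1) =
      -(β + n + 1) * hahnQ n x α β (M + 1) +
        (2 * n + α + β + 2) * (1 - x / (M + 1)) * hahnQ n x α (β + 1) M := by
  have h := sum_hahnTerm_telescope α β x hα M n hn n le_rfl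
  rw [Finset.sum_sub_distrib, Finset.sum_add_distrib, ← Finset.mul_sum, ← Finset.mul_sum,
    ← Finset.mul_sum, ← hahnQ_eq_sum, ← hahnQ_eq_sum] at h
  rw [hahnQ_eq_sum (n + 1), Finset.sum_range_succ]
  -- The top term is kept out of the telescoping: for `n = M` the factor `(-M)_{n+1}` vanishes. It
  -- cancels the boundary term left at `m = n`.
  have hlast : (α + n + 1) * hahnTerm (n + 1) x α β (M + 1) (n + 1) =
      ((2 * n + α + β + 2) / (M + 1)) * (hahnTerm n x α (β + 1) M n * (n - x)) := by
    have e1 : risingFactorial (-((n : ℝ) + 1)) (n + 1)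
        = -((n : ℝ) + 1) * risingFactorial (-(n : ℝ)) n := by
      rw [risingFactorial_succ_left]; congr 2; ring
    have e3 : risingFactorial (-((M : ℝ) + 1)) (n + 1)
        = -((M : ℝ) + 1) * risingFactorial (-(M : ℝ)) n := by
      rw [risingFactorial_succ_left]; congr 2; ring
    have e4 : (n : ℝ) + 1 + α + β + 1 = (n : ℝ) + α + β + 2 := by ring
    have e5 : (n : ℝ) + α + (β + 1) + 1 = (n : ℝ) + α + β + 2 := by ring
    have hC := (risingFactorial_pos (show 0 < α + 1 by linarith) n).ne'
    have hC' : α + 1 + n ≠ 0 := by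
      have : (0 : ℝ) ≤ n := n.cast_nonneg
      linarith
    have hD := risingFactorial_neg_ne_zero hn
    have hF : (Nat.factorial n : ℝ) ≠ 0 := by exact_mod_cast n.factorial_ne_zero
    have hm1 : (n : ℝ) + 1 ≠ 0 := by positivity
    have hM : (M : ℝ) + 1 ≠ 0 := by positivity
    simp only [hahnTerm, Nat.cast_add, Nat.cast_one, e4, e5, e1, e3, Nat.factorial_succ,
      Nat.cast_mul, risingFactorial_succ _ n]
    generalize risingFactorial (-(n : ℝ)) n = X
    generalize risingFactorial ((n : ℝ) + α + β + 2) n = Y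
    generalize risingFactorial (-x) n = Z
    generalize risingFactorial (α + 1) n = C at hC ⊢
    generalize risingFactorial (-(M : ℝ)) n = D at hD ⊢
    generalize (Nat.factorial n : ℝ) = F at hF ⊢
    field_simp
    ring
  linear_combination h + hlast

/-- Holds summand by summand, once the degree `n` sum is padded with its vanishing term of index `n
+ 1`. -/
theorem hahnQ_succ_sub_shift (α β x : ℝ) (hαβ : -1 < α + β) (hα : -1 < α) (M n : ℕ)
    (hn : n + 1 ≤ M) :
    (n + α + β + 2) * (M - n) *
        (hahnQ (n + 1) x α β (M + 1) - hahnQ (n + 1) x α (β + 1) M) =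
      -((n + 1) * (n + α + β + M + 3)) *
        (hahnQ (n + 1) x α β (M + 1) - hahnQ n x α (β + 1) M) := by
  rw [hahnQ_eq_sum (n + 1), hahnQ_eq_sum (n + 1), hahnQ_eq_sum_succ n,
    ← Finset.sum_sub_distrib, ← Finset.sum_sub_distrib, Finset.mul_sum, Finset.mul_sum]
  refine Finset.sum_congr rfl fun k hk => ?_
  have hkn : k ≤ n + 1 := by
    have := Finset.mem_range.1 hk
    omega
  have hn1 : (n : ℝ) + 1 ≠ 0 := by positivity
  have hs : (n : ℝ) + α + β + 2 ≠ 0 := by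
    have : (0 : ℝ) ≤ n := n.cast_nonneg
    linarith
  have hM : (M : ℝ) + 1 ≠ 0 := by positivity
  have hMk : (M : ℝ) + 1 - k ≠ 0 := by
    have : (k : ℝ) ≤ M := by exact_mod_cast hkn.trans hn
    linarith
  have e1 : risingFactorial (-(n : ℝ)) k
      = risingFactorial (-((n : ℝ) + 1)) k * (n + 1 - k) / (n + 1) := by
    have h := risingFactorial_add_one_mul (-((n : ℝ) + 1)) k
    rw [show -((n : ℝ) + 1) + 1 = -(n : ℝ) by ring] at h
    rw [eq_div_iff hn1]
    linear_combination -h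
  have e2 : risingFactorial ((n : ℝ) + α + β + 3) k
      = risingFactorial ((n : ℝ) + α + β + 2) k * (n + α + β + 2 + k) / (n + α + β + 2) := by
    have h := risingFactorial_add_one_mul ((n : ℝ) + α + β + 2) k
    rw [show (n : ℝ) + α + β + 2 + 1 = (n : ℝ) + α + β + 3 by ring] at h
    rw [eq_div_iff hs]
    linear_combination h
  have e3 : risingFactorial (-(M : ℝ)) k
      = risingFactorial (-((M : ℝ) + 1)) k * (M + 1 - k) / (M + 1) := by
    have h := risingFactorial_add_one_mul (-((M : ℝ) + 1)) k
    rw [show -((M : ℝ) + 1) + 1 = -(M : ℝ) by ring] at h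
    rw [eq_div_iff hM]
    linear_combination -h
  have e4 : (n : ℝ) + 1 + α + β + 1 = (n : ℝ) + α + β + 2 := by ring
  have e5 : (n : ℝ) + α + (β + 1) + 1 = (n : ℝ) + α + β + 2 := by ring
  have e6 : (n : ℝ) + 1 + α + (β + 1) + 1 = (n : ℝ) + α + β + 3 := by ring
  have hC := (risingFactorial_pos (show 0 < α + 1 by linarith) k).ne'
  have hG : risingFactorial (-((M : ℝ) + 1)) k ≠ 0 := by
    have := risingFactorial_neg_ne_zero (show k ≤ M + 1 by omega)
    rwa [Nat.cast_add, Nat.cast_one] at this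
  have hF : (Nat.factorial k : ℝ) ≠ 0 := by exact_mod_cast k.factorial_ne_zero
  simp only [hahnTerm, Nat.cast_add, Nat.cast_one, e4, e5, e6, e1, e2, e3]
  generalize risingFactorial (-((n : ℝ) + 1)) k = X
  generalize risingFactorial ((n : ℝ) + α + β + 2) k = Y
  generalize risingFactorial (-x) k = Z
  generalize risingFactorial (α + 1) k = C at hC ⊢
  generalize risingFactorial (-((M : ℝ) + 1)) k = G at hG ⊢
  generalize (Nat.factorial k : ℝ) = F at hF ⊢
  field_simp
  ring

/-- At `x = N` the factor `1 - x / N` kills the shifted term of `hahnQ_succ`, leaving a first-order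
recurrence. -/
theorem hahnQ_right (α β : ℝ) (hα : -1 < α) (N n : ℕ) (hn : n ≤ N) :
    hahnQ n (N : ℝ) α β N =
      (-1) ^ n * (risingFactorial (β + 1) n / risingFactorial (α + 1) n) := by
  induction n with
  | zero => simp [hahnQ_degree_zero, risingFactorial_zero]
  | succ n ih =>
    obtain ⟨M, rfl⟩ : ∃ M, N = M + 1 := ⟨N - 1, by omega⟩
    have h := hahnQ_succ α β ((M + 1 : ℕ) : ℝ) hα M n (by omega)
    have hM : (M : ℝ) + 1 ≠ 0 := by positivity
    have hC := (risingFactorial_pos (show 0 < α + 1 by linarith) n).ne'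
    have hC' : α + 1 + n ≠ 0 := by
      have : (0 : ℝ) ≤ n := n.cast_nonneg
      linarith
    rw [ih (by omega), Nat.cast_add, Nat.cast_one, div_self hM] at h
    rw [risingFactorial_succ, risingFactorial_succ, Nat.cast_add, Nat.cast_one]
    apply mul_left_cancel₀ hC'
    field_simp
    field_simp at h
    linear_combination h

/-! ### Growth of the quadratic form -/

/-- One step of the sum of squares argument: if `p' = a p + (1 - a) (1 - x / N) v`, then the
quadratic form at `(p', v)` is at most `max 1 (a ^ 2)` times the one at `(p, v)`. -/
theorem quadratic_step {N x a p p' v L : ℝ} (hx : 0 < x) (hxN : x ≤ N) (h1 : 1 ≤ L)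
    (ha : a ^ 2 ≤ L) (hp : p' = a * p + (1 - a) * (1 - x / N) * v) :
    p' ^ 2 + (N - x) / x * (p' - v) ^ 2 ≤ L * (p ^ 2 + (N - x) / x * (p - v) ^ 2) := by
  have hN : 0 < N := hx.trans_le hxN
  have key : L * (p ^ 2 + (N - x) / x * (p - v) ^ 2) -
      (p' ^ 2 + (N - x) / x * (p' - v) ^ 2) =
      (L - 1) * (1 - x / N) * v ^ 2 +
        (L - a ^ 2) * (N / x) * (p - v + x / N * v) ^ 2 := by
    rw [hp]
    field_simp
    ring
  have h2 : 0 ≤ 1 - x / N := by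
    rw [sub_nonneg, div_le_one hN]
    exact hxN
  have h3 : 0 ≤ (L - 1) * (1 - x / N) * v ^ 2 :=
    mul_nonneg (mul_nonneg (by linarith) h2) (sq_nonneg v)
  have h4 : 0 ≤ (L - a ^ 2) * (N / x) * (p - v + x / N * v) ^ 2 :=
    mul_nonneg (mul_nonneg (by linarith) (by positivity)) (sq_nonneg _)
  linarith

theorem quadratic_succ_le (α β x : ℝ) (hα : -1 < α) (M n : ℕ) (hn : n ≤ M)
    (hx : 0 < x) (hxM : x ≤ M + 1) {L : ℝ} (h1 : 1 ≤ L)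
    (hL : ((β + n + 1) / (α + n + 1)) ^ 2 ≤ L) :
    hahnQ (n + 1) x α β (M + 1) ^ 2 + (M + 1 - x) / x *
        (hahnQ (n + 1) x α β (M + 1) - hahnQ n x α (β + 1) M) ^ 2 ≤
      L * (hahnQ n x α β (M + 1) ^ 2 + (M + 1 - x) / x *
        (hahnQ n x α β (M + 1) - hahnQ n x α (β + 1) M) ^ 2) := by
  have hC' : α + n + 1 ≠ 0 := by
    have : (0 : ℝ) ≤ n := n.cast_nonneg
    linarith
  refine quadratic_step (a := -((β + n + 1) / (α + n + 1))) hx hxM h1 (by simpa using hL) ?_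
  apply mul_left_cancel₀ hC'
  rw [hahnQ_succ α β x hα M n hn]
  generalize 1 - x / ((M : ℝ) + 1) = w
  field_simp
  ring

theorem quadratic_le (α β x : ℝ) (hα : -1 < α) (hαβ : -1 < α + β) (M n : ℕ) (hn : n ≤ M)
    (hx : 0 < x) (hxM : x ≤ M + 1)
    (hd : 2 * (n : ℝ) * (n + α + β + 1) ≤ (M + 1) * (α + β + 1))
    (L B : ℕ → ℝ) (h1 : ∀ k, 1 ≤ L k)
    (hL : ∀ k : ℕ, ((β + k + 1) / (α + k + 1)) ^ 2 ≤ L k)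
    (hB0 : B 0 = 1) (hB : ∀ k, B (k + 1) = L k * B k) :
    hahnQ n x α β (M + 1) ^ 2 + (M + 1 - x) / x *
        (hahnQ n x α β (M + 1) - hahnQ n x α (β + 1) M) ^ 2 ≤ B n := by
  induction n with
  | zero => simp [hahnQ_degree_zero, hB0]
  | succ n ih =>
    push_cast at hd
    have hn0 : (0 : ℝ) ≤ n := n.cast_nonneg
    have hnM : (n : ℝ) + 1 ≤ M := by exact_mod_cast hn
    -- The degree condition passes down to smaller `n`.
    have hB' := ih (by omega) (by nlinarith)
    have hstep := quadratic_succ_le α β x hα M n (by omega) hx hxM (h1 n) (hL n)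
    have hshift := hahnQ_succ_sub_shift α β x hαβ hα M n hn
    set p := hahnQ (n + 1) x α β (M + 1)
    set d := p - hahnQ (n + 1) x α (β + 1) M
    set d' := p - hahnQ n x α (β + 1) M
    have hu : 0 < ((n : ℝ) + α + β + 2) * (M - n) := mul_pos (by linarith) (by linarith)
    have hw : 0 ≤ ((n : ℝ) + 1) * (n + α + β + M + 3) :=
      mul_nonneg (by linarith) (by linarith)
    -- Expanded, this is exactly `hd`.
    have hle : ((n : ℝ) + 1) * (n + α + β + M + 3) ≤ (n + α + β + 2) * (M - n) := by
      nlinarith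
    have hd2 : d ^ 2 ≤ d' ^ 2 := by
      have hab : |d| ≤ |d'| := by
        have h := congrArg abs hshift
        rw [abs_mul _ d, abs_mul _ d', abs_neg, abs_of_pos hu, abs_of_nonneg hw] at h
        refine le_of_mul_le_mul_left ?_ hu
        rw [h]
        exact mul_le_mul_of_nonneg_right hle (abs_nonneg _)
      exact sq_le_sq.2 hab
    have hc : 0 ≤ ((M : ℝ) + 1 - x) / x := div_nonneg (by linarith) hx.le
    calc p ^ 2 + (M + 1 - x) / x * d ^ 2 ≤ p ^ 2 + (M + 1 - x) / x * d' ^ 2 := by gcongr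
      _ ≤ _ := hstep
      _ ≤ L n * B n := mul_le_mul_of_nonneg_left hB' (by linarith [h1 n])
      _ = B (n + 1) := (hB n).symm

/-- The last step needs no passage to `v_{n+1}`, so the degree condition is required only at `n`,
one below the degree bounded. -/
theorem hahnQ_sq_le (α β x : ℝ) (hα : -1 < α) (hαβ : -1 < α + β) (M n : ℕ) (hn : n ≤ M)
    (hx : 0 < x) (hxM : x ≤ M + 1)
    (hd : 2 * (n : ℝ) * (n + α + β + 1) ≤ (M + 1) * (α + β + 1))
    (L B : ℕ → ℝ) (h1 : ∀ k, 1 ≤ L k)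
    (hL : ∀ k : ℕ, ((β + k + 1) / (α + k + 1)) ^ 2 ≤ L k)
    (hB0 : B 0 = 1) (hB : ∀ k, B (k + 1) = L k * B k) :
    hahnQ (n + 1) x α β (M + 1) ^ 2 ≤ B (n + 1) := by
  have h := quadratic_le α β x hα hαβ M n hn hx hxM hd L B h1 hL hB0 hB
  have hstep := quadratic_succ_le α β x hα M n hn hx hxM (h1 n) (hL n)
  have hc : 0 ≤ ((M : ℝ) + 1 - x) / x := div_nonneg (by linarith) hx.le
  have hpos := mul_nonneg hc (sq_nonneg (hahnQ (n + 1) x α β (M + 1) - hahnQ n x α (β + 1) M))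
  rw [hB]
  have := mul_le_mul_of_nonneg_left h (show 0 ≤ L n by linarith [h1 n])
  linarith

/-! ### Degree threshold and conclusion -/

theorem degree_condition (α β : ℝ) (hαβ : -1 < α + β) (N n : ℕ)
    (hn : ((n + 1 : ℕ) : ℝ) ≤ hahnDegreeBound α β N) :
    2 * (n : ℝ) * (n + α + β + 1) ≤ N * (α + β + 1) := by
  have hn0 : (0 : ℝ) ≤ n := n.cast_nonneg
  have hN0 : (0 : ℝ) ≤ N := N.cast_nonneg
  have hrad : 0 ≤ (α + β + 1) * (α + β + 2 * (N : ℝ) + 1) :=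
    mul_nonneg (by linarith) (by linarith)
  unfold hahnDegreeBound at hn
  push_cast at hn
  have h : 2 * (n : ℝ) + 1 + (α + β) ≤ √((α + β + 1) * (α + β + 2 * (N : ℝ) + 1)) := by
    linarith
  have := (Real.le_sqrt (by linarith) hrad).1 h
  nlinarith

theorem hahnQ_abs_le (α β : ℝ) (hα : -1 < α) (hβ : -1 < β) (hαβ : -1 < α + β)
    (N n : ℕ) (hnN : n ≤ N) (hn : (n : ℝ) ≤ hahnDegreeBound α β N) (x : ℝ)
    (hx : x ∈ Set.Icc (0 : ℝ) (N : ℝ)) :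
    |hahnQ n x α β N| ≤ max 1 (risingFactorial (β + 1) n / risingFactorial (α + 1) n) := by
  -- The weight `(N - x)/x` is singular at `x = 0`.
  rcases hx.1.eq_or_lt with rfl | hx0
  · simp [hahnQ_zero]
  cases n with
  | zero => simp [hahnQ_degree_zero]
  | succ n =>
    obtain ⟨M, rfl⟩ : ∃ M, N = M + 1 := ⟨N - 1, by omega⟩
    have hd := degree_condition α β hαβ (M + 1) n hn
    have hxM := hx.2
    push_cast at hd hxM
    have hpos : ∀ k : ℕ, 0 < α + k + 1 := fun k => by
      have : (0 : ℝ) ≤ k := k.cast_nonneg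
      linarith
    have hpos' : ∀ k : ℕ, 0 < β + k + 1 := fun k => by
      have : (0 : ℝ) ≤ k := k.cast_nonneg
      linarith
    rcases le_total β α with hab | hab
    · refine le_max_of_le_left ?_
      have h := hahnQ_sq_le α β x hα hαβ M n (by omega) hx0 hxM hd (fun _ => 1) (fun _ => 1)
        (fun _ => le_rfl)
        (fun k => pow_le_one₀ (div_pos (hpos' k) (hpos k)).le
          ((div_le_one (hpos k)).2 (by linarith))) rfl (fun _ => by simp)
      exact (sq_le_one_iff_abs_le_one _).1 h
    · refine le_max_of_le_right ?_
      have h := hahnQ_sq_le α β x hα hαβ M n (by omega) hx0 hxM hd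
        (fun k => ((β + k + 1) / (α + k + 1)) ^ 2)
        (fun k => (risingFactorial (β + 1) k / risingFactorial (α + 1) k) ^ 2)
        (fun k => one_le_pow₀ ((one_le_div (hpos k)).2 (by linarith)))
        (fun _ => le_rfl) (by simp [risingFactorial_zero]) (fun k => by
          simp only [risingFactorial_succ]
          rw [← mul_pow, mul_div_mul_comm, mul_comm, add_right_comm β, add_right_comm α])
      exact abs_le_of_sq_le_sq h
        (div_pos (risingFactorial_pos (by linarith) _) (risingFactorial_pos (by linarith) _)).le

theorem theorem3p2 (α β : ℝ) (hα : -1 < α) (hβ : -1 < β) (hαβ : -1 < α + β)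
    (N n : ℕ) (hnN : n ≤ N) (hn : (n : ℝ) ≤ hahnDegreeBound α β N) :
    (∀ x : ℝ, x ∈ Set.Icc (0 : ℝ) (N : ℝ) →
      |hahnQ n x α β N| ≤ max 1 (risingFactorial (β + 1) n / risingFactorial (α + 1) n)) ∧
    max 1 (risingFactorial (β + 1) n / risingFactorial (α + 1) n) =
      max |hahnQ n 0 α β N| |hahnQ n (N : ℝ) α β N| := by
  refine ⟨hahnQ_abs_le α β hα hβ hαβ N n hnN hn, ?_⟩
  have hr : 0 < risingFactorial (β + 1) n / risingFactorial (α + 1) n :=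
    div_pos (risingFactorial_pos (by linarith) _) (risingFactorial_pos (by linarith) _)
  rw [hahnQ_zero, hahnQ_right α β hα N n hnN, abs_mul, abs_pow, abs_neg, abs_one, one_pow,
    one_mul, abs_of_pos hr]
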